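/- Let $\mathcal{X},\mathcal{Y}$ be finite sets and let $p_{Y|X}$ be a discrete memoryless channel (DMC) from $\mathcal{X}$ to $\mathcal{Y}$, i.e. $p_{Y|X}(\cdot|x)$ is a probability vector on $\mathcal{Y}$ for every $x\in\mathcal{X}$. Definitions. A pricing downward closed (DC) cone over a set $\mathcal{Y}$ is a set $A\subseteq\mathbb{R}^{\mathcal{Y}}$ such that $\gamma a-b\in A$ whenever $a\in A$, $\gamma\ge 0$ and $b\in\mathbb{R}_{\ge0}^{\mathcal{Y}}$. A game-theoretic channel $W$ from $\mathcal{X}$ to $\mathcal{Y}$ assigns a pricing DC cone $W(x)$ over $\mathcal{Y}$ to each $x\in\mathcal{X}$. For integers $n,L\ge 1$ and $0<\epsilon<1$: (a) The channel coding game $(W,n,L,\epsilon)$ is a guaranteed win if there are functions $x^n:[L]\to\mathcal{X}^n$, $w_i:[L]\times\mathcal{Y}^{i-1}\to\mathbb{R}^{\mathcal{Y}}$ ($1\le i\le n$) and $\hat m:\mathcal{Y}^n\to[L]$ such that $w_i(m,y^{i-1})\in W(x_i(m))$ for all $i,m,y^{i-1}$, and $\sum_{i=1}^n w_i(m,y^{i-1})(y_i)-\mathbf{1}\{\hat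 m(y^n)\ne m\}\ge-\epsilon$ for all $m\in[L]$, $y^n\in\mathcal{Y}^n$. (b) For pricing DC cones $A$ over $\mathcal{Y}$ and $B$ over $\mathcal{Z}$, let $A\ltimes B$ be the cone of all functions $(y,z)\mapsto a(y)+f(y,z)$ on $\mathcal{Y}\times\mathcal{Z}$ with $a\in A$ and $f(y,\cdot)\in B$ for every $y$. The one-pass channel coding game $(W,n,L,\epsilon)$ is a guaranteed win if there are functions $w:[L]\to\bigcup_{x^n\in\mathcal{X}^n}W(x_1)\ltimes\cdots\ltimes W(x_n)\subseteq\mathbb{R}^{\mathcal{Y}^n}$ and $\hat m:\mathcal{Y}^n\to[L]$ such that $w(m)(y^n)-\mathbf{1}\{\hat m(y^n)\neq m\}\ge-\epsilon$ for all $m\in[L]$, $y^n\in\mathcal{Y}^n$. (c) A (non-feedback) coding scheme for $p_{Y|X}$ with blocklength $n$, message cardinality $L$ and maximum error probability $\epsilon$ is a pair $f:[L]\to\mathcal{X}^n$, $g:\mathcal{Y}^n\to[L]$ such that for every $m\in[L]$, if $Y_1,\ldots,Y_n$ are independent with $Y_i\sim p_{Y|X}(\cdot|f(m)_i)$, then $\mathbb{P}(g(Y^n)\ne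 m)\le\epsilon$. The capacity $\mathrm{C}(W)$ is the supremum of the rates $R\ge0$ such that for every $n_0\ge1$ and $0<\epsilon<1$ there is $n\ge n_0$ for which the channel coding game $(W,n,\lfloor 2^{nR}\rfloor,\epsilon)$ is a guaranteed win. The operational capacity of $p_{Y|X}$ is the supremum of the rates $R\ge0$ such that for every $n_0\ge1$ and $\epsilon>0$ there is $n\ge n_0$ for which a coding scheme with blocklength $n$, message cardinality $\lfloor2^{nR}\rfloor$ and maximum error probability $\epsilon$ exists. (Suprema are taken in $[-\infty,\infty]$, with $\sup\emptyset=-\infty$.) Theorem. Let $W_{\mathrm{dmc}}(x):=(p_{Y|X}(\cdot|x))^{\circ}=\{a\in\mathbb{R}^{\mathcal{Y}}:\sum_{y}p_{Y|X}(y|x)a(y)\le0\}$. For all integers $n,L\ge1$ and all $0<\epsilon<1$, the channel coding game $(W_{\mathrm{dmc}},n,L,\epsilon)$ is a guaranteed win if and only if a coding scheme exists for $p_{Y|X}$ with blocklength $n$, message cardinality $L$ and maximum error probability $\epsilon$; and the same equivalence holds for the one-pass channel coding game $(W_{\mathrm{dmc}},n,L,\epsilon)$. Hence $\mathrm{C}(W_{\mathrm{dmc}})$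 equals the Shannon capacity of $p_{Y|X}$: it equals the operational capacity of $p_{Y|X}$, and it equals $\sup_{p_X}I(X;Y)$, where the supremum is over all probability vectors $p_X$ on $\mathcal{X}$ and $I(X;Y)=\sum_{x,y}p_X(x)p_{Y|X}(y|x)\log_2\frac{p_{Y|X}(y|x)}{\sum_{x'}p_X(x')p_{Y|X}(y|x')}$. -/

import Mathlib

/-- A pricing downward closed cone over `Y`: a set of payoff functions `Y → ℝ` (possibly empty,
not necessarily convex) closed under scaling by `γ ≥ 0` and under decreasing the payoffs. -/
structure DCCone (Y : Type*) where
  carrier : Set (Y → ℝ)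
  smul_mem : ∀ γ : ℝ, 0 ≤ γ → ∀ a ∈ carrier, γ • a ∈ carrier
  lower : ∀ a ∈ carrier, ∀ b : Y → ℝ, b ≤ a → b ∈ carrier

namespace DCCone

/-- The nonpositive cone `ℝ_{≤0}^Y`. -/
def nonpos (Y : Type*) : DCCone Y where
  carrier := {a | a ≤ 0}
  smul_mem := fun _ hγ _ ha y => mul_nonpos_of_nonneg_of_nonpos hγ (ha y)
  lower := fun _ ha _ hb => hb.trans ha

/-- The halfspace cone `p° = {a : ⟨p, a⟩ ≤ 0}` of a probability vector `p`. -/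
def halfspace {Y : Type*} [Fintype Y] (p : stdSimplex ℝ Y) : DCCone Y where
  carrier := {a | ∑ y, p.1 y * a y ≤ 0}
  smul_mem := by
    intro γ hγ a ha
    have h : ∑ y, p.1 y * (γ • a) y = γ * ∑ y, p.1 y * a y := by
      rw [Finset.mul_sum]
      refine Finset.sum_congr rfl fun y _ => ?_
      simp only [Pi.smul_apply, smul_eq_mul]
      ring
    change ∑ y, p.1 y * (γ • a) y ≤ 0
    rw [h]
    exact mul_nonpos_of_nonneg_of_nonpos hγ ha
  lower := fun _ ha _ hb =>
    (Finset.sum_le_sum fun y _ => mul_le_mul_of_nonneg_left (hb y) (p.2.1 y)).trans ha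

/-- The union of a family of cones. -/
def iUnion {ι Y : Type*} (A : ι → DCCone Y) : DCCone Y where
  carrier := ⋃ i, (A i).carrier
  smul_mem := by
    intro γ hγ a ha
    obtain ⟨i, hi⟩ := Set.mem_iUnion.1 ha
    exact Set.mem_iUnion.2 ⟨i, (A i).smul_mem γ hγ a hi⟩
  lower := by
    intro a ha b hb
    obtain ⟨i, hi⟩ := Set.mem_iUnion.1 ha
    exact Set.mem_iUnion.2 ⟨i, (A i).lower a hi b hb⟩

/-- The semidirect product `A ⋉ F`: choose `a ∈ A` and, depending on the outcome `y`, a further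
payoff function `f (y, ·) ∈ F y`; the total payoff is `a y + f (y, z)`. -/
def semidirect {Y Z : Type*} (A : DCCone Y) (F : Y → DCCone Z) : DCCone (Y × Z) where
  carrier := {s | ∃ a ∈ A.carrier, ∃ f : Y × Z → ℝ,
    (∀ y, (fun z => f (y, z)) ∈ (F y).carrier) ∧ s = fun q => a q.1 + f q}
  smul_mem := by
    rintro γ hγ s ⟨a, ha, f, hf, rfl⟩
    refine ⟨γ • a, A.smul_mem γ hγ a ha, γ • f, fun y => (F y).smul_mem γ hγ _ (hf y), ?_⟩
    funext q
    simp [mul_add]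
  lower := by
    rintro s ⟨a, ha, f, hf, rfl⟩ b hb
    refine ⟨a, ha, fun q => b q - a q.1, fun y => (F y).lower _ (hf y) _ fun z => ?_, ?_⟩
    · have := hb (y, z)
      simp only at this ⊢
      linarith
    · funext q
      ring

/-- The pushforward `f # A = {b : b ∘ f ∈ A}`. -/
def pushforward {Y Z : Type*} (f : Y → Z) (A : DCCone Y) : DCCone Z where
  carrier := {b | (fun y => b (f y)) ∈ A.carrier}
  smul_mem := fun γ hγ _ hb => A.smul_mem γ hγ _ hb
  lower := fun _ ha _ hb => A.lower _ ha _ fun y => hb (f y)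

/-- The iterated semidirect product `A₁ ⋉ ⋯ ⋉ Aₙ` as a cone over `Yⁿ`, where `Y × Yⁿ` is identified
with `Yⁿ⁺¹` by prepending. The cone `ℝ_{≤0}` over the one-point set `Y⁰` is the neutral element. -/
def iterSemidirect {Y : Type*} : (n : ℕ) → (Fin n → DCCone Y) → DCCone (Fin n → Y)
  | 0, _ => nonpos (Fin 0 → Y)
  | n + 1, A =>
    pushforward (fun q : Y × (Fin n → Y) => (Fin.cons q.1 q.2 : Fin (n + 1) → Y))
      (semidirect (A 0) fun _ => iterSemidirect n fun i => A i.succ)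

end DCCone

namespace GameChannel

/-- The channel coding game `(W, n, L, ε)` is a guaranteed win: the encoder has a rule
`m ↦ xⁿ` and rules `(m, y₁, …, y_{i-1}) ↦ w_i ∈ W(x_i)`, and the decoder a rule `yⁿ ↦ m̂`, such that
the total payoff is at least `-ε` whatever `m` and `yⁿ` the adversary chooses. -/
def IsGuaranteedWin {X Y : Type*} (W : X → DCCone Y) (n L : ℕ) (ε : ℝ) : Prop :=
  ∃ (x : Fin L → Fin n → X)
    (w : Fin L → (i : Fin n) → (Fin (i : ℕ) → Y) → (Y → ℝ))
    (dec : (Fin n → Y) → Fin L),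
    (∀ m i h, w m i h ∈ (W (x m i)).carrier) ∧
    ∀ (m : Fin L) (y : Fin n → Y),
      -ε ≤ (∑ i : Fin n, w m i (fun j => y (Fin.castLE i.isLt.le j)) (y i))
        - (if dec y ≠ m then 1 else 0)

/-- The `n`-use cone `⋃_{xⁿ} W(x₁) ⋉ ⋯ ⋉ W(xₙ)`. -/
def nUseCone {X Y : Type*} (W : X → DCCone Y) (n : ℕ) : DCCone (Fin n → Y) :=
  DCCone.iUnion fun x : Fin n → X => DCCone.iterSemidirect n fun i => W (x i)

/-- The one-pass channel coding game `(W, n, L, ε)` is a guaranteed win: the encoder has a rule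
choosing, given the message, an element of the `n`-use cone, and the decoder a rule `yⁿ ↦ m̂`. -/
def IsOnePassGuaranteedWin {X Y : Type*} (W : X → DCCone Y) (n L : ℕ) (ε : ℝ) : Prop :=
  ∃ (w : Fin L → (Fin n → Y) → ℝ) (dec : (Fin n → Y) → Fin L),
    (∀ m, w m ∈ (nUseCone W n).carrier) ∧
    ∀ (m : Fin L) (y : Fin n → Y), -ε ≤ w m y - (if dec y ≠ m then 1 else 0)

/-- The game-theoretic capacity `C(W)`, in bits. The supremum is taken in the extended reals, so
that it is `-∞` if there is no achievable rate (no strategy) and `∞` if every rate is. -/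
noncomputable def capacity {X Y : Type*} (W : X → DCCone Y) : EReal :=
  ⨆ R ∈ {R : ℝ | 0 ≤ R ∧ ∀ n₀ : ℕ, 0 < n₀ → ∀ ε : ℝ, 0 < ε → ε < 1 →
    ∃ n : ℕ, n₀ ≤ n ∧ IsGuaranteedWin W n ⌊(2 : ℝ) ^ ((n : ℝ) * R)⌋₊ ε}, (R : EReal)

end GameChannel

namespace DMC

/-- The conditional error probability `P(g(Yⁿ) ≠ m | Xⁿ = xⁿ)` when `xⁿ` is sent over the discrete
memoryless channel `p`, i.e. when the `Y_i` are independent with `Y_i ∼ p(· | x_i)`. -/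
noncomputable def errorProb {X Y : Type*} [Fintype Y] (p : X → stdSimplex ℝ Y) {n L : ℕ}
    (x : Fin n → X) (g : (Fin n → Y) → Fin L) (m : Fin L) : ℝ :=
  ∑ y : Fin n → Y with g y ≠ m, ∏ i, (p (x i)).1 (y i)

/-- A (non-feedback) coding scheme with blocklength `n`, message cardinality `L` and maximum error
probability (at most) `ε` exists for the discrete memoryless channel `p`. -/
def CodeExists {X Y : Type*} [Fintype Y] (p : X → stdSimplex ℝ Y) (n L : ℕ) (ε : ℝ) : Prop :=
  ∃ (f : Fin L → Fin n → X) (g : (Fin n → Y) → Fin L), ∀ m, errorProb p (f m) g m ≤ ε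

/-- The operational capacity, in bits: the supremum of the achievable rates. -/
noncomputable def operationalCapacity {X Y : Type*} [Fintype Y] (p : X → stdSimplex ℝ Y) : EReal :=
  ⨆ R ∈ {R : ℝ | 0 ≤ R ∧ ∀ n₀ : ℕ, 0 < n₀ → ∀ ε : ℝ, 0 < ε →
    ∃ n : ℕ, n₀ ≤ n ∧ CodeExists p n ⌊(2 : ℝ) ^ ((n : ℝ) * R)⌋₊ ε}, (R : EReal)

/-- The mutual information `I(X;Y)`, in bits, of the input distribution `q` and the channel `p`:
`∑ q(x) p(y|x) log₂ (p(y|x) / p_Y(y))`, where `p_Y(y) = ∑ q(x') p(y|x')`. A term with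
`q(x) p(y|x) = 0` is `0`, and in any other term `p_Y(y) > 0`. -/
noncomputable def mutualInfo {X Y : Type*} [Fintype X] [Fintype Y] (q : stdSimplex ℝ X)
    (p : X → stdSimplex ℝ Y) : ℝ :=
  ∑ x, ∑ y, q.1 x * (p x).1 y * Real.logb 2 ((p x).1 y / ∑ x', q.1 x' * (p x').1 y)

/-- The information capacity `max_{p_X} I(X;Y)`, in bits. -/
noncomputable def informationCapacity {X Y : Type*} [Fintype X] [Fintype Y]
    (p : X → stdSimplex ℝ Y) : EReal :=
  ⨆ q : stdSimplex ℝ X, (mutualInfo q p : EReal)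

/-- The game-theoretic channel `W_dmc(x) = p(· | x)°` of the discrete memoryless channel `p`. -/
def gameChannel {X Y : Type*} [Fintype Y] (p : X → stdSimplex ℝ Y) : X → DCCone Y :=
  fun x => DCCone.halfspace (p x)

end DMC

/-! ### Sequential strategies and product halfspaces. -/

namespace DCCone

/-! A bet on one letter is allowed exactly when its mean under the letter's law is at most `0`.
Taking conditional means letter by letter, the bets reachable over `n` letters form the same kind of
halfspace, now for the product law (`DCCone.mem_iterSemidirect_halfspace`). To win with decoder `g`,
message `m` needs the payoff `1{g y ≠ m} - ε`, whose mean is the error probability minus `ε`; hence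
winning means having a code. One-pass and sequential play agree because the elements of the iterated
cone are the functions dominated by sequential strategies.

The capacity statement then reduces to Shannon's coding theorem. For the converse, a Gibbs
inequality compares each codeword's output law with the product of the codebook's averaged output
marginals; the divergence splits into single-letter mutual informations. For achievability,
Feinstein's greedy construction (`DMC.exists_code_of_likelihood_ratio`) is combined with a Chernoff
bound on the log-likelihood ratio. -/

/-- The continuation payoff is determined by `F` and the first bet `a`, so only `a` remains
quantified. -/
theorem mem_iterSemidirect_succ {Y : Type*} {n : ℕ} {A : Fin (n + 1) → DCCone Y}
    {F : (Fin (n + 1) → Y) → ℝ} :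
    F ∈ (iterSemidirect (n + 1) A).carrier ↔
      ∃ a ∈ (A 0).carrier, ∀ y, (fun z : Fin n → Y => F (Fin.cons y z) - a y) ∈
        (iterSemidirect n fun i => A i.succ).carrier := by
  constructor
  · rintro ⟨a, ha, f, hf, h⟩
    refine ⟨a, ha, fun y => ?_⟩
    convert! hf y using 1
    funext z
    have := congrFun h (y, z)
    simp only at this
    rw [this]
    ring
  · rintro ⟨a, ha, hF⟩
    refine ⟨a, ha, fun q => F (Fin.cons q.1 q.2) - a q.1, hF, ?_⟩
    funext q
    ring

/-- A payoff function lies in the iterated semidirect product iff it is dominated by the total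
payoff of a sequential strategy. -/
theorem mem_iterSemidirect_iff_exists_strategy {Y : Type*} {n : ℕ} {A : Fin n → DCCone Y}
    {F : (Fin n → Y) → ℝ} :
    F ∈ (iterSemidirect n A).carrier ↔
      ∃ w : (i : Fin n) → (Fin (i : ℕ) → Y) → (Y → ℝ), (∀ i h, w i h ∈ (A i).carrier) ∧
        ∀ y, F y ≤ ∑ i : Fin n, w i (fun j => y (Fin.castLE i.isLt.le j)) (y i) := by
  induction n with
  | zero =>
    constructor
    · intro h
      exact ⟨fun i => i.elim0, fun i => i.elim0, fun y => by simpa using h y⟩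
    · rintro ⟨w, -, h⟩ y
      simpa using h y
  | succ n ih =>
    rw [mem_iterSemidirect_succ]
    constructor
    · rintro ⟨a, ha, hF⟩
      choose w hw hle using fun y => ih.1 (hF y)
      -- Later bets read the first letter off the history to select a continuation, which then sees
      -- only the tail.
      refine ⟨Fin.cases (fun _ => a) fun i h =>
        w (h ⟨0, Nat.succ_pos _⟩) i (Fin.tail (n := (i : ℕ)) h), ?_, ?_⟩
      · intro i
        refine Fin.cases ?_ ?_ i
        · intro _
          exact ha
        · intro i h
          exact hw _ _ _
      · intro y
        have := hle (y 0) (Fin.tail y)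
        rw [Fin.cons_self_tail] at this
        rw [Fin.sum_univ_succ]
        have h2 := sub_le_iff_le_add'.1 this
        exact h2
    · rintro ⟨w, hw, hle⟩
      refine ⟨w 0 Fin.elim0, hw _ _, fun y => ih.2
        ⟨fun i h => w i.succ (Fin.cons y h), fun i h => hw _ _, fun z => ?_⟩⟩
      have := hle (Fin.cons y z)
      rw [Fin.sum_univ_succ] at this
      refine sub_le_iff_le_add'.2 (this.trans_eq ?_)
      congr 1
      · simp only [Fin.cons_zero]
        congr 1
        funext j
        exact j.elim0
      · refine Finset.sum_congr rfl fun i _ => ?_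
        simp only [Fin.cons_succ]
        congr 1
        funext j
        refine Fin.cases rfl (fun j => rfl) j

/-- The iterated semidirect product of halfspaces is the halfspace of the product measure. -/
theorem mem_iterSemidirect_halfspace {Y : Type*} [Fintype Y] {n : ℕ}
    {P : Fin n → stdSimplex ℝ Y} {F : (Fin n → Y) → ℝ} :
    F ∈ (iterSemidirect n fun i => halfspace (P i)).carrier ↔
      ∑ y : Fin n → Y, (∏ i, (P i).1 (y i)) * F y ≤ 0 := by
  induction n with
  | zero =>
    rw [Fintype.sum_unique]
    simp only [Finset.univ_eq_empty, Finset.prod_empty, one_mul]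
    exact ⟨fun h => h _, fun h y => by rwa [Subsingleton.elim y default]⟩
  | succ n ih =>
    rw [mem_iterSemidirect_succ, ← (Fin.consEquiv fun _ => Y).sum_comp, Fintype.sum_prod_type]
    simp only [Fin.consEquiv, Equiv.coe_fn_mk, Fin.prod_univ_succ, Fin.cons_zero, Fin.cons_succ]
    have hone : ∑ z : Fin n → Y, ∏ i : Fin n, (P i.succ).1 (z i) = 1 := by
      rw [← Fintype.prod_sum]
      exact Finset.prod_eq_one fun i _ => (P i.succ).2.2
    have key (a : Y → ℝ) (y : Y) : ∑ z : Fin n → Y, (∏ i : Fin n, (P i.succ).1 (z i)) *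
        (F (Fin.cons y z) - a y) =
        (∑ z : Fin n → Y, (∏ i : Fin n, (P i.succ).1 (z i)) * F (Fin.cons y z)) - a y := by
      simp only [mul_sub, Finset.sum_sub_distrib, ← Finset.sum_mul, hone, one_mul]
    simp only [ih, key, sub_nonpos, mul_assoc, ← Finset.mul_sum]
    constructor
    · rintro ⟨a, ha, h⟩
      exact (Finset.sum_le_sum fun y _ => mul_le_mul_of_nonneg_left (h y) ((P 0).2.1 y)).trans ha
    · intro h
      -- The first bet is the conditional mean of `F` given the first letter, the smallest one that
      -- leaves a feasible continuation.
      exact ⟨_, h, fun y => le_rfl⟩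

end DCCone

/-! ### Sequential versus one-pass play. -/

namespace GameChannel

/-- The sequential and the one-pass channel coding games are won together. -/
theorem isGuaranteedWin_iff_isOnePassGuaranteedWin {X Y : Type*} (W : X → DCCone Y) (n L : ℕ)
    (ε : ℝ) : IsGuaranteedWin W n L ε ↔ IsOnePassGuaranteedWin W n L ε := by
  constructor
  · rintro ⟨x, w, dec, hw, h⟩
    exact ⟨_, dec, fun m => Set.mem_iUnion.2 ⟨x m,
      DCCone.mem_iterSemidirect_iff_exists_strategy.2 ⟨w m, hw m, fun y => le_rfl⟩⟩, h⟩
  · rintro ⟨F, dec, hF, h⟩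
    choose x hx using fun m => Set.mem_iUnion.1 (hF m)
    choose w hw hle using fun m => DCCone.mem_iterSemidirect_iff_exists_strategy.1 (hx m)
    exact ⟨x, w, dec, hw, fun m y => (h m y).trans (sub_le_sub_right (hle m y) _)⟩

end GameChannel

/-! ### Winning strategies versus codes. -/

namespace DMC

variable {X Y : Type*} [Fintype Y] (p : X → stdSimplex ℝ Y)

theorem sum_prod_eq_one {n : ℕ} (x : Fin n → X) :
    ∑ y : Fin n → Y, ∏ i, (p (x i)).1 (y i) = 1 := by
  rw [← Fintype.prod_sum]
  exact Finset.prod_eq_one fun i _ => (p (x i)).2.2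

/-- This payoff is the least one that wins for `m` with decoder `g`; since cones are downward
closed, its membership settles whether `x` can serve as the codeword. -/
theorem mem_iterSemidirect_error_iff {n L : ℕ} (ε : ℝ) (x : Fin n → X)
    (g : (Fin n → Y) → Fin L) (m : Fin L) :
    (fun y => (if g y ≠ m then (1 : ℝ) else 0) - ε) ∈
      (DCCone.iterSemidirect n fun i => gameChannel p (x i)).carrier ↔ errorProb p x g m ≤ ε := by
  unfold gameChannel
  rw [DCCone.mem_iterSemidirect_halfspace]
  simp only [mul_sub, Finset.sum_sub_distrib, ← Finset.sum_mul, sum_prod_eq_one, one_mul,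
    mul_ite, mul_one, mul_zero, ← Finset.sum_filter, sub_nonpos, errorProb]

theorem isOnePassGuaranteedWin_iff_codeExists (n L : ℕ) (ε : ℝ) :
    GameChannel.IsOnePassGuaranteedWin (gameChannel p) n L ε ↔ CodeExists p n L ε := by
  constructor
  · rintro ⟨F, g, hF, h⟩
    choose x hx using fun m => Set.mem_iUnion.1 (hF m)
    refine ⟨x, g, fun m => (mem_iterSemidirect_error_iff p ε (x m) g m).1 ?_⟩
    refine DCCone.lower _ _ (hx m) _ fun y => ?_
    have := h m y
    simp only
    linarith
  · rintro ⟨x, g, h⟩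
    refine ⟨fun m y => (if g y ≠ m then (1 : ℝ) else 0) - ε, g, fun m => Set.mem_iUnion.2
      ⟨x m, (mem_iterSemidirect_error_iff p ε (x m) g m).2 (h m)⟩, fun m y => ?_⟩
    simp

theorem isGuaranteedWin_iff_codeExists (n L : ℕ) (ε : ℝ) :
    GameChannel.IsGuaranteedWin (gameChannel p) n L ε ↔ CodeExists p n L ε :=
  (GameChannel.isGuaranteedWin_iff_isOnePassGuaranteedWin _ n L ε).trans
    (isOnePassGuaranteedWin_iff_codeExists p n L ε)

variable {p} in
theorem CodeExists.mono {n L : ℕ} {ε ε' : ℝ} (h : CodeExists p n L ε) (hε : ε ≤ ε') :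
    CodeExists p n L ε' :=
  let ⟨f, g, hfg⟩ := h
  ⟨f, g, fun m => (hfg m).trans hε⟩

theorem capacity_gameChannel_eq_operationalCapacity :
    GameChannel.capacity (gameChannel p) = operationalCapacity p := by
  unfold GameChannel.capacity operationalCapacity
  refine iSup_congr fun R => iSup_congr_Prop ?_ fun _ => rfl
  simp only [isGuaranteedWin_iff_codeExists, Set.mem_ofPred_eq]
  refine and_congr_right fun _ => forall₂_congr fun n₀ _ => ⟨fun h ε hε => ?_,
    fun h ε hε _ => h ε hε⟩
  -- The game only allows `ε < 1`, whereas the operational definition allows every `ε > 0`.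
  obtain ⟨n, hn, hc⟩ := h (min ε (1 / 2)) (by positivity)
    ((min_le_right _ _).trans_lt (by norm_num))
  exact ⟨n, hn, hc.mono (min_le_left _ _)⟩

end DMC

/-! ### Converse of the coding theorem. -/

namespace DMC

section Converse

variable {X Y : Type*} [Fintype Y] (p : X → stdSimplex ℝ Y)

/-- The empirical distribution of a finite sequence of letters. -/
noncomputable def empirical [Fintype X] {L : ℕ} (hL : 0 < L) (x : Fin L → X) : stdSimplex ℝ X :=
  letI := Classical.decEq X
  ⟨fun a => (∑ m, if x m = a then 1 else 0) / L, fun a => by positivity, by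
    rw [← Finset.sum_div, Finset.sum_comm]
    simp [hL.ne']⟩

theorem sum_empirical_mul [Fintype X] {L : ℕ} (hL : 0 < L) (x : Fin L → X) (h : X → ℝ) :
    ∑ a, (empirical hL x).1 a * h a = (∑ m, h (x m)) / L := by
  classical
  simp only [empirical, div_mul_eq_mul_div, Finset.sum_mul]
  rw [← Finset.sum_div, Finset.sum_comm]
  simp

/-- The other coordinates sum out to `1`; this reduces the divergence to single letters. -/
theorem sum_prod_mul_apply {n : ℕ} (x : Fin n → X) (i : Fin n) (h : Y → ℝ) :
    ∑ y : Fin n → Y, (∏ j, (p (x j)).1 (y j)) * h (y i) = ∑ b, (p (x i)).1 b * h b := by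
  have h1 (y : Fin n → Y) : (∏ j, (p (x j)).1 (y j)) * h (y i) =
      ∏ j, (p (x j)).1 (y j) * (if j = i then h (y j) else 1) := by
    rw [Finset.prod_mul_distrib, Finset.prod_ite_eq' Finset.univ i fun j => h (y j)]
    simp
  simp only [h1]
  rw [← Fintype.prod_sum fun j b => (p (x j)).1 b * (if j = i then h b else 1),
    Finset.prod_eq_single i]
  · simp
  · intro j _ hj
    simp only [if_neg hj, mul_one]
    exact (p (x j)).2.2
  · simp

theorem sum_filter_eq_add_errorProb {n L : ℕ} (x : Fin n → X) (g : (Fin n → Y) → Fin L)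
    (m : Fin L) : ∑ y : Fin n → Y, (∏ i, (p (x i)).1 (y i)) * (if g y = m then 1 else 0) =
      1 - errorProb p x g m := by
  rw [errorProb, Finset.sum_filter, eq_sub_iff_add_eq, ← Finset.sum_add_distrib]
  refine (Finset.sum_congr rfl fun y _ => ?_).trans (sum_prod_eq_one p x)
  by_cases h : g y = m <;> simp [h]

/-- A weighted Gibbs inequality. -/
theorem mul_sub_log_div_le {P Q φ c : ℝ} (hP : 0 ≤ P) (hQ : 0 ≤ Q) (hPQ : P ≠ 0 → Q ≠ 0)
    (hc : 0 < c) :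
    P * (φ - Real.log (P / Q)) ≤ Q * Real.exp φ / c + (Real.log c - 1) * P := by
  rcases hP.eq_or_lt with rfl | hP
  · simp only [zero_mul, mul_zero, add_zero]
    positivity
  have hQ : 0 < Q := hQ.lt_of_ne (hPQ hP.ne').symm
  have h := Real.log_le_sub_one_of_pos (show 0 < Q * Real.exp φ / (P * c) by positivity)
  rw [Real.log_div (by positivity) (by positivity), Real.log_mul hQ.ne' (Real.exp_pos _).ne',
    Real.log_exp, Real.log_mul hP.ne' hc.ne'] at h
  rw [Real.log_div hP.ne' hQ.ne']
  calc P * (φ - (Real.log P - Real.log Q))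
      ≤ P * (Q * Real.exp φ / (P * c) + (Real.log c - 1)) := by
        refine mul_le_mul_of_nonneg_left ?_ hP.le
        linarith
    _ = _ := by field_simp

/-- Fano-type converse: a code with maximum error probability `ε` satisfies
`(1 - ε) log₂ L ≤ n C + 1`. -/
theorem one_sub_mul_logb_le_of_codeExists [Fintype X] {n L : ℕ} {ε c : ℝ} (hL : 0 < L)
    (hc : ∀ q : stdSimplex ℝ X, mutualInfo q p ≤ c) (h : CodeExists p n L ε) :
    (1 - ε) * Real.logb 2 L ≤ n * c + 1 := by
  obtain ⟨f, g, hfg⟩ := h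
  have hLr : (0 : ℝ) < L := by exact_mod_cast hL
  have hL1 : (1 : ℝ) ≤ L := by exact_mod_cast hL
  -- `r i` is the law of the `i`-th output under a uniform message, equivalently the output law for
  -- the empirical input distribution of the `i`-th codeword letters.
  set r : Fin n → Y → ℝ := fun i b => (∑ m, (p (f m i)).1 b) / L with hr
  have hr0 (i b) : 0 ≤ r i b := div_nonneg (Finset.sum_nonneg fun m _ => (p (f m i)).2.1 b) hLr.le
  have hrpos (m i b) (hb : (p (f m i)).1 b ≠ 0) : 0 < r i b :=
    div_pos (Finset.sum_pos' (fun m _ => (p (f m i)).2.1 b)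
      ⟨m, Finset.mem_univ _, ((p (f m i)).2.1 b).lt_of_ne hb.symm⟩) hLr
  have hr1 (i) : ∑ b, r i b = 1 := by
    simp only [hr]
    rw [← Finset.sum_div, Finset.sum_comm, Finset.sum_congr rfl fun m _ => (p (f m i)).2.2]
    simp [hLr.ne']
  set P : Fin L → (Fin n → Y) → ℝ := fun m y => ∏ i, (p (f m i)).1 (y i) with hP
  set Q : (Fin n → Y) → ℝ := fun y => ∏ i, r i (y i) with hQ
  have hQ0 (y) : 0 ≤ Q y := Finset.prod_nonneg fun i _ => hr0 _ _
  have hQ1 : ∑ y, Q y = 1 := by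
    simp only [hQ]
    rw [← Fintype.prod_sum]
    exact Finset.prod_eq_one fun i _ => hr1 i
  have hP0 (m y) : 0 ≤ P m y := Finset.prod_nonneg fun i _ => (p (f m i)).2.1 _
  have hP1 (m) : ∑ y, P m y = 1 := sum_prod_eq_one p (f m)
  have hfac (m y) (hm : P m y ≠ 0) (i) : (p (f m i)).1 (y i) ≠ 0 :=
    Finset.prod_ne_zero_iff.1 hm i (Finset.mem_univ _)
  have hlog (m y) : P m y * Real.log (P m y / Q y) =
      ∑ i, P m y * Real.log ((p (f m i)).1 (y i) / r i (y i)) := by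
    rw [← Finset.mul_sum]
    by_cases hm : P m y = 0
    · rw [hm, zero_mul, zero_mul]
    · congr 1
      rw [← Real.log_prod fun i _ =>
        (div_ne_zero (hfac m y hm i) (hrpos m i _ (hfac m y hm i)).ne'), Finset.prod_div_distrib]
  have hinfo (i) : (∑ m, ∑ b, (p (f m i)).1 b * Real.log ((p (f m i)).1 b / r i b)) ≤
      L * (c * Real.log 2) := by
    have h2 := hc (empirical hL fun m => f m i)
    have h3 : mutualInfo (empirical hL fun m => f m i) p =
        (∑ m, ∑ b, (p (f m i)).1 b * Real.logb 2 ((p (f m i)).1 b / r i b)) / L := by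
      unfold mutualInfo
      simp only [mul_assoc, ← Finset.mul_sum]
      simp only [sum_empirical_mul hL (fun m => f m i) fun x => (p x).1 _]
      rw [sum_empirical_mul hL (fun m => f m i) fun x =>
        ∑ b, (p x).1 b * Real.logb 2 ((p x).1 b / r i b)]
    simp only [Real.logb, ← mul_div_assoc, ← Finset.sum_div] at h3
    rw [h3, div_div, div_le_iff₀ (mul_pos (Real.log_pos one_lt_two) hLr)] at h2
    linarith
  have hdiv : ∑ m, ∑ y, P m y * Real.log (P m y / Q y) ≤ L * (n * (c * Real.log 2)) := by
    calc ∑ m, ∑ y, P m y * Real.log (P m y / Q y)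
        = ∑ i, ∑ m, ∑ b, (p (f m i)).1 b * Real.log ((p (f m i)).1 b / r i b) := by
          rw [Finset.sum_comm (s := (Finset.univ : Finset (Fin n)))]
          refine Finset.sum_congr rfl fun m _ => ?_
          simp only [hlog]
          rw [Finset.sum_comm]
          exact Finset.sum_congr rfl fun i _ =>
            sum_prod_mul_apply p (f m) i fun b => Real.log ((p (f m i)).1 b / r i b)
      _ ≤ ∑ i : Fin n, L * (c * Real.log 2) := Finset.sum_le_sum fun i _ => hinfo i
      _ = L * (n * (c * Real.log 2)) := by
          rw [Finset.sum_const, Finset.card_univ, Fintype.card_fin, nsmul_eq_mul]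
          ring
  -- For fixed `y`, `exp φ` sums over `m` to `L + (L - 1) ≤ 2 * L`, because exactly one message is
  -- decoded. Taking `c = 2` balances this and leaves an excess of `log 2` per message: the `+ 1`
  -- bit.
  have hgibbs (m y) := mul_sub_log_div_le (φ := (if g y = m then 1 else 0) * Real.log L)
    (hP0 m y) (hQ0 y) (fun hm => (Finset.prod_pos fun i _ => hrpos m i _ (hfac m y hm i)).ne')
    two_pos
  have hsum := Finset.sum_le_sum fun m (_ : m ∈ Finset.univ) =>
    Finset.sum_le_sum fun y (_ : y ∈ Finset.univ) => hgibbs m y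
  simp only [mul_sub, Finset.sum_sub_distrib, Finset.sum_add_distrib, ← Finset.mul_sum, hP1]
    at hsum
  have hexp : ∑ m : Fin L, ∑ y, Q y * Real.exp ((if g y = m then 1 else 0) * Real.log L) / 2 ≤
      L := by
    rw [Finset.sum_comm]
    calc ∑ y, ∑ m : Fin L, Q y * Real.exp ((if g y = m then 1 else 0) * Real.log L) / 2
        = ∑ y, Q y * ((L + (L - 1)) / 2) := by
          refine Finset.sum_congr rfl fun y _ => ?_
          rw [← Finset.sum_div, ← Finset.mul_sum, mul_div_assoc]
          congr 2
          have (m : Fin L) : Real.exp ((if g y = m then 1 else 0) * Real.log L) =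
              1 + if g y = m then (L : ℝ) - 1 else 0 := by
            split_ifs <;> simp [Real.exp_log hLr]
          simp only [this, Finset.sum_add_distrib, Finset.sum_ite_eq, Finset.mem_univ, if_true]
          simp
      _ = (L + (L - 1)) / 2 := by rw [← Finset.sum_mul, hQ1, one_mul]
      _ ≤ L := by linarith
  have hsucc : L * ((1 - ε) * Real.log L) ≤
      ∑ m, ∑ y, P m y * ((if g y = m then 1 else 0) * Real.log L) := by
    calc L * ((1 - ε) * Real.log L) = ∑ m : Fin L, (1 - ε) * Real.log L := by simp
      _ ≤ _ := Finset.sum_le_sum fun m _ => by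
        simp only [← mul_assoc, ← Finset.sum_mul]
        refine mul_le_mul_of_nonneg_right ?_ (Real.log_nonneg hL1)
        have := sum_filter_eq_add_errorProb p (f m) g m
        have h4 := hfg m
        simp only [hP]
        linarith
  have hfin : L * ((1 - ε) * Real.log L) ≤ L * ((n * c + 1) * Real.log 2) := by
    simp only [Finset.sum_const, Finset.card_univ, Fintype.card_fin, nsmul_eq_mul, mul_one]
      at hsum
    linarith
  have := le_of_mul_le_mul_left hfin hLr
  rw [Real.logb, ← mul_div_assoc, div_le_iff₀ (Real.log_pos one_lt_two)]
  exact this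

theorem rate_le_of_codeExists [Fintype X] {R c : ℝ} (hR : 0 ≤ R)
    (hc : ∀ q : stdSimplex ℝ X, mutualInfo q p ≤ c)
    (h : ∀ n₀ : ℕ, 0 < n₀ → ∀ ε : ℝ, 0 < ε →
      ∃ n : ℕ, n₀ ≤ n ∧ CodeExists p n ⌊(2 : ℝ) ^ ((n : ℝ) * R)⌋₊ ε) : R ≤ c := by
  -- Error `1 / (k + 1)` and blocklength at least `k + 1` are used together. The `2` counts one bit
  -- lost in the converse and at most one in the floor.
  have hbound (k : ℕ) : (1 - ((k : ℝ) + 1)⁻¹) * R ≤ c + 2 * ((k : ℝ) + 1)⁻¹ := by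
    have hk : (0 : ℝ) < ((k : ℝ) + 1)⁻¹ := by positivity
    have hk1 : ((k : ℝ) + 1)⁻¹ ≤ 1 := inv_le_one_of_one_le₀ (by simp)
    obtain ⟨n, hn, hcode⟩ := h (k + 1) k.succ_pos _ hk
    have hn' : (k : ℝ) + 1 ≤ n := by exact_mod_cast hn
    have hn0 : (0 : ℝ) < n := by linarith [Nat.cast_nonneg (α := ℝ) k]
    set M := (2 : ℝ) ^ ((n : ℝ) * R) with hM
    have hM1 : 1 ≤ M := Real.one_le_rpow one_le_two (by positivity)
    have hfl : 0 < ⌊M⌋₊ := Nat.floor_pos.2 hM1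
    have hconv := one_sub_mul_logb_le_of_codeExists p hfl hc hcode
    have hfl2 : M / 2 ≤ ⌊M⌋₊ := by
      have h1 := Nat.lt_floor_add_one M
      have h2 : (1 : ℝ) ≤ ⌊M⌋₊ := by exact_mod_cast hfl
      linarith
    have hlog : n * R - 1 ≤ Real.logb 2 ⌊M⌋₊ := by
      rw [Real.le_logb_iff_rpow_le one_lt_two (by exact_mod_cast hfl), Real.rpow_sub two_pos,
        Real.rpow_one]
      exact hfl2
    have h3 : (1 - ((k : ℝ) + 1)⁻¹) * (n * R - 1) ≤ n * c + 1 :=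
      (mul_le_mul_of_nonneg_left hlog (sub_nonneg.2 hk1)).trans hconv
    have h4 : 1 ≤ n * ((k : ℝ) + 1)⁻¹ := by
      rw [← div_eq_mul_inv, le_div_iff₀ (by positivity)]
      linarith
    refine le_of_mul_le_mul_left ?_ hn0
    nlinarith
  have hlim' : Filter.Tendsto (fun k : ℕ => ((k : ℝ) + 1)⁻¹) Filter.atTop (nhds 0) := by
    simpa using tendsto_one_div_add_atTop_nhds_zero_nat (𝕜 := ℝ)
  have := le_of_tendsto_of_tendsto' ((hlim'.const_sub 1).mul_const R)
    ((hlim'.const_mul 2).const_add c) hbound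
  simpa using this

theorem operationalCapacity_le_informationCapacity [Fintype X] :
    operationalCapacity p ≤ informationCapacity p := by
  refine iSup₂_le fun R hR => ?_
  obtain ⟨hR0, hR⟩ := hR
  refine EReal.le_of_forall_lt_iff_le.1 fun c hc => EReal.coe_le_coe_iff.2 ?_
  exact rate_le_of_codeExists p hR0
    (fun q => EReal.coe_le_coe_iff.1 ((le_iSup (fun q => (mutualInfo q p : EReal)) q).trans hc.le))
    hR

end Converse

end DMC

/-! ### Feinstein's greedy construction. -/

namespace DMC

section Feinstein

open scoped Classical in
/-- Feinstein's lemma for finite alphabets: greedy construction of a code with small maximum error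
probability from the distribution of the likelihood ratio. -/
theorem exists_code_of_likelihood_ratio {A B : Type*} [Fintype A] [Fintype B] {q : A → ℝ}
    {P : A → B → ℝ} (hq0 : ∀ a, 0 ≤ q a) (hq1 : ∑ a, q a = 1) (hP0 : ∀ a b, 0 ≤ P a b)
    (hP1 : ∀ a, ∑ b, P a b = 1) {K ε : ℝ} (hK : 0 < K) {L : ℕ} (hL : 0 < L)
    (hε : L / K + ∑ a, ∑ b, (if P a b ≤ K * ∑ a', q a' * P a' b then q a * P a b else 0) ≤ ε) :
    ∃ (f : Fin L → A) (g : B → Fin L), ∀ m, ∑ b with g b ≠ m, P (f m) b ≤ ε := by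
  set Q : B → ℝ := fun b => ∑ a', q a' * P a' b with hQ
  -- A partial code with `k` codewords: `g b ≥ k` marks an unassigned output, and every assigned
  -- output has likelihood ratio at least `K`.
  have hstep : ∀ k : ℕ, k ≤ L → ∃ (f : ℕ → A) (g : B → ℕ),
      (∀ m < k, 1 - ε ≤ ∑ b with g b = m, P (f m) b) ∧
      ∀ b, g b < k → K * Q b ≤ P (f (g b)) b := by
    intro k
    induction k with
    | zero =>
      intro _
      have : Nonempty A := by
        by_contra h
        rw [not_nonempty_iff] at h
        simp at hq1
      exact ⟨fun _ => Classical.arbitrary A, fun _ => 0, by simp, by simp⟩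
    | succ k ih =>
      intro hk
      obtain ⟨f, g, hf, hg⟩ := ih (Nat.le_of_succ_le hk)
      -- Each decoding region has `P`-mass at most `1`, hence `Q`-mass at most `1 / K`.
      have hused : ∑ b with g b < k, Q b ≤ k / K := by
        have hmap : ∀ b ∈ Finset.univ.filter (fun b => g b < k), g b ∈ Finset.range k :=
          fun b hb => Finset.mem_range.2 (Finset.mem_filter.1 hb).2
        rw [← Finset.sum_fiberwise_of_maps_to hmap]
        calc _ ≤ ∑ m ∈ Finset.range k, 1 / K := by
              refine Finset.sum_le_sum fun m hm => ?_
              rw [le_div_iff₀ hK, Finset.sum_mul]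
              calc _ ≤ ∑ b ∈ (Finset.univ.filter (fun b => g b < k)).filter (fun b => g b = m),
                      P (f m) b := by
                    refine Finset.sum_le_sum fun b hb => ?_
                    obtain ⟨hbk, rfl⟩ := Finset.mem_filter.1 hb
                    rw [mul_comm]
                    exact hg b (Finset.mem_filter.1 hbk).2
                _ ≤ ∑ b, P (f m) b := Finset.sum_le_sum_of_subset_of_nonneg
                    (Finset.subset_univ _) fun b _ _ => hP0 _ _
                _ = 1 := hP1 _
          _ = k / K := by
              rw [Finset.sum_const, Finset.card_range, nsmul_eq_mul, mul_one_div]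
      obtain ⟨a, ha⟩ : ∃ a, 1 - ε ≤ ∑ b with k ≤ g b ∧ K * Q b < P a b, P a b := by
        by_contra! hcon
        -- Every output is newly usable, of low likelihood, or already assigned. Averaging over `q`
        -- contradicts the hypothesis on `ε` if no `a` has enough newly usable mass.
        have h1 (a : A) : 1 ≤ (∑ b with k ≤ g b ∧ K * Q b < P a b, P a b) +
            (∑ b, if P a b ≤ K * Q b then P a b else 0) + ∑ b with g b < k, P a b := by
          rw [← hP1 a, Finset.sum_filter, Finset.sum_filter, ← Finset.sum_add_distrib,
            ← Finset.sum_add_distrib]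
          refine Finset.sum_le_sum fun b _ => ?_
          have := hP0 a b
          rcases lt_or_ge (g b) k with h1 | h1 <;> rcases le_or_gt (P a b) (K * Q b) with h2 | h2
          · simp [h1, h2, h2.not_gt, this]
          · simp [h1, h2, h1.not_ge, h2.not_ge]
          · simp [h1.not_gt, h2, h2.not_gt]
          · simp [h1, h2, h1.not_gt, h2.not_ge]
        have h2 : (1 : ℝ) ≤ (∑ a, q a * ∑ b with k ≤ g b ∧ K * Q b < P a b, P a b) +
            (∑ a, ∑ b, if P a b ≤ K * Q b then q a * P a b else 0) + ∑ b with g b < k, Q b := by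
          have := Finset.sum_le_sum fun a (_ : a ∈ Finset.univ) =>
            mul_le_mul_of_nonneg_left (h1 a) (hq0 a)
          simp only [mul_one, hq1, mul_add, Finset.sum_add_distrib] at this
          refine this.trans_eq ?_
          congr 1
          · congr 1
            simp only [Finset.mul_sum, mul_ite, mul_zero]
          · simp only [Finset.mul_sum, hQ]
            exact Finset.sum_comm
        have h3 : ∑ a, q a * ∑ b with k ≤ g b ∧ K * Q b < P a b, P a b < 1 - ε := by
          calc _ < ∑ a, q a * (1 - ε) := by
                obtain ⟨a, -, ha⟩ := Finset.exists_ne_zero_of_sum_ne_zero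
                  (hq1.symm ▸ one_ne_zero : ∑ a, q a ≠ 0)
                exact Finset.sum_lt_sum
                  (fun a _ => mul_le_mul_of_nonneg_left (hcon a).le (hq0 a))
                  ⟨a, Finset.mem_univ _, mul_lt_mul_of_pos_left (hcon a)
                    ((hq0 a).lt_of_ne ha.symm)⟩
            _ = 1 - ε := by rw [← Finset.sum_mul, hq1, one_mul]
        have h4 : (k : ℝ) / K ≤ L / K := by
          have : (k : ℝ) ≤ L := by exact_mod_cast Nat.le_of_succ_le hk
          gcongr
        linarith
      refine ⟨Function.update f k a,
        fun b => if g b < k then g b else if K * Q b < P a b then k else k + 1, ?_, ?_⟩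
      · intro m hm
        rcases Nat.lt_succ_iff_lt_or_eq.1 hm with hm | rfl
        · rw [Function.update_of_ne hm.ne]
          refine (hf m hm).trans_eq (Finset.sum_congr (Finset.filter_congr fun b _ => ?_)
            fun _ _ => rfl)
          simp only
          split_ifs <;> omega
        · rw [Function.update_self]
          refine ha.trans_eq (Finset.sum_congr (Finset.filter_congr fun b _ => ?_)
            fun _ _ => rfl)
          simp only
          split_ifs with h1 h2
          · exact ⟨fun h => absurd h1 h.1.not_gt, fun h => absurd h1 (by omega)⟩
          · exact ⟨fun _ => rfl, fun _ => ⟨not_lt.1 h1, h2⟩⟩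
          · exact ⟨fun h => absurd h.2 h2, fun h => by omega⟩
      · intro b
        simp only
        split_ifs with h1 h2
        · intro _
          rw [Function.update_of_ne h1.ne]
          exact hg b h1
        · intro _
          rw [Function.update_self]
          exact h2.le
        · intro h
          omega
  obtain ⟨f, g, hf, -⟩ := hstep L le_rfl
  -- Sending unassigned outputs to message `0` only enlarges a decoding region.
  refine ⟨fun m => f m, fun b => if h : g b < L then ⟨g b, h⟩ else ⟨0, hL⟩, fun m => ?_⟩
  have h1 := hf m m.2
  have h2 := Finset.sum_filter_add_sum_filter_not Finset.univ (fun b => g b = m) (P (f m))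
  rw [hP1] at h2
  have h3 : ∑ b with (if h : g b < L then (⟨g b, h⟩ : Fin L) else ⟨0, hL⟩) ≠ m, P (f m) b ≤
      ∑ b with ¬ g b = m, P (f m) b := by
    refine Finset.sum_le_sum_of_subset_of_nonneg (fun b hb => ?_) fun b _ _ => hP0 _ _
    simp only [Finset.mem_filter, Finset.mem_univ, true_and] at hb ⊢
    rintro hbm
    refine hb ?_
    have hlt : g b < L := hbm ▸ m.2
    rw [dif_pos hlt]
    exact Fin.ext hbm
  linarith

end Feinstein

/-! ### Chernoff bound and achievability. -/

section Achievability

/-- Chernoff: a finite distribution with positive mean has an exponential moment below one. -/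
theorem exists_sum_mul_exp_neg_lt_one {Ω : Type*} [Fintype Ω] {μ z : Ω → ℝ} (hμ : ∑ ω, μ ω = 1)
    (hz : 0 < ∑ ω, μ ω * z ω) : ∃ t > 0, ∑ ω, μ ω * Real.exp (-(t * z ω)) < 1 := by
  -- The exponential moment is `1` at `t = 0`, with derivative minus the mean of `z`.
  have hd : HasDerivAt (fun t : ℝ => ∑ ω, μ ω * Real.exp (-(t * z ω)))
      (∑ ω, μ ω * (Real.exp (-(0 * z ω)) * -(1 * z ω))) 0 :=
    HasDerivAt.fun_sum fun ω _ =>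
      ((((hasDerivAt_id (0 : ℝ)).mul_const (z ω)).fun_neg).exp).const_mul (μ ω)
  have hneg : ∑ ω, μ ω * (Real.exp (-(0 * z ω)) * -(1 * z ω)) < 0 := by
    simpa using hz
  have := (hasDerivAt_iff_tendsto_slope.1 hd).eventually_lt_const hneg
  have hright := (this.filter_mono (nhdsWithin_mono 0
    (fun t (ht : t ∈ Set.Ioi (0 : ℝ)) => (ne_of_gt ht : t ≠ 0)))).and self_mem_nhdsWithin
  obtain ⟨t, ht, ht0⟩ := hright.exists
  refine ⟨t, ht0, ?_⟩
  have ht0 : 0 < t := ht0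
  rw [slope_def_field, sub_zero, div_lt_iff₀ ht0, zero_mul, sub_neg] at ht
  simpa [hμ] using ht

variable {X Y : Type*} [Fintype X] [Fintype Y] (p : X → stdSimplex ℝ Y)

/-- Below the mutual information, codes exist at all large block lengths. -/
theorem eventually_codeExists (q : stdSimplex ℝ X) {R : ℝ} (hR : 0 ≤ R) (hRI : R < mutualInfo q p)
    {ε : ℝ} (hε : 0 < ε) :
    ∀ᶠ n : ℕ in Filter.atTop, CodeExists p n ⌊(2 : ℝ) ^ ((n : ℝ) * R)⌋₊ ε := by
  classical
  -- With threshold `K = 2 ^ (n * r)`, the gap `R < r` makes `L / K` vanish, and `r < I` makes the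
  -- low-likelihood event a large deviation.
  obtain ⟨r, hRr, hrI⟩ := exists_between hRI
  set μ : X × Y → ℝ := fun ω => q.1 ω.1 * (p ω.1).1 ω.2 with hμ
  set s : Y → ℝ := fun b => ∑ x', q.1 x' * (p x').1 b with hs
  set z : X × Y → ℝ := fun ω => Real.log ((p ω.1).1 ω.2 / s ω.2) - r * Real.log 2 with hz
  have hlog2 := Real.log_pos one_lt_two
  have hμ0 (ω) : 0 ≤ μ ω := mul_nonneg (q.2.1 _) ((p _).2.1 _)
  have hμ1 : ∑ ω, μ ω = 1 := by
    rw [Fintype.sum_prod_type]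
    simp only [hμ, ← Finset.mul_sum]
    rw [Finset.sum_congr rfl fun x _ => by rw [(p x).2.2, mul_one], q.2.2]
  have hmean : 0 < ∑ ω, μ ω * z ω := by
    have : ∑ ω, μ ω * z ω = (mutualInfo q p - r) * Real.log 2 := by
      simp only [hz, mul_sub, Finset.sum_sub_distrib, ← Finset.sum_mul, hμ1, sub_mul, one_mul]
      congr 1
      rw [Fintype.sum_prod_type, mutualInfo, Finset.sum_mul]
      refine Finset.sum_congr rfl fun x _ => ?_
      rw [Finset.sum_mul]
      refine Finset.sum_congr rfl fun y _ => ?_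
      rw [Real.logb, mul_assoc (_ * _), div_mul_cancel₀ _ hlog2.ne']
    rw [this]
    exact mul_pos (sub_pos.2 hrI) hlog2
  obtain ⟨t, ht0, ht⟩ := exists_sum_mul_exp_neg_lt_one hμ1 hmean
  set ρ := ∑ ω, μ ω * Real.exp (-(t * z ω)) with hρ
  have hρ0 : 0 ≤ ρ := Finset.sum_nonneg fun ω _ => mul_nonneg (hμ0 ω) (Real.exp_pos _).le
  have hlim : Filter.Tendsto (fun n : ℕ => ((2 : ℝ) ^ (R - r)) ^ n + ρ ^ n) Filter.atTop
      (nhds (0 + 0)) :=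
    (tendsto_pow_atTop_nhds_zero_of_lt_one (by positivity)
      (Real.rpow_lt_one_of_one_lt_of_neg one_lt_two (sub_neg.2 hRr))).add
      (tendsto_pow_atTop_nhds_zero_of_lt_one hρ0 ht)
  rw [add_zero] at hlim
  filter_upwards [hlim.eventually_le_const hε] with n hn
  have hM1 : 1 ≤ (2 : ℝ) ^ ((n : ℝ) * R) := Real.one_le_rpow one_le_two (by positivity)
  refine exists_code_of_likelihood_ratio (q := fun x : Fin n → X => ∏ i, q.1 (x i))
    (P := fun x (y : Fin n → Y) => ∏ i, (p (x i)).1 (y i)) (K := (2 : ℝ) ^ ((n : ℝ) * r))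
    (fun x => Finset.prod_nonneg fun i _ => q.2.1 _) ?_
    (fun x y => Finset.prod_nonneg fun i _ => (p _).2.1 _) (sum_prod_eq_one p) (by positivity)
    (Nat.floor_pos.2 hM1) (le_trans (add_le_add ?_ ?_) hn)
  · rw [← Fintype.prod_sum]
    exact Finset.prod_eq_one fun i _ => q.2.2
  · rw [div_le_iff₀ (by positivity), ← Real.rpow_natCast, ← Real.rpow_mul zero_le_two,
      ← Real.rpow_add two_pos]
    refine (Nat.floor_le (by positivity)).trans_eq ?_
    congr 1
    ring
  · have hsprod (y : Fin n → Y) :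
        ∑ x : Fin n → X, (∏ i, q.1 (x i)) * ∏ i, (p (x i)).1 (y i) = ∏ i, s (y i) := by
      simp only [← Finset.prod_mul_distrib, hs]
      rw [← Fintype.prod_sum fun (i : Fin n) x => q.1 x * (p x).1 (y i)]
    have hρn : ρ ^ n = ∑ x : Fin n → X, ∑ y : Fin n → Y,
        ∏ i, μ (x i, y i) * Real.exp (-(t * z (x i, y i))) := by
      rw [Finset.sum_congr rfl fun (x : Fin n → X) _ => (Fintype.prod_sum fun (i : Fin n) b =>
        μ (x i, b) * Real.exp (-(t * z (x i, b)))).symm]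
      rw [← Fintype.prod_sum fun (i : Fin n) x => ∑ b, μ (x, b) * Real.exp (-(t * z (x, b)))]
      rw [Finset.prod_const, Finset.card_univ, Fintype.card_fin, hρ, Fintype.sum_prod_type]
    rw [hρn]
    refine Finset.sum_le_sum fun x _ => Finset.sum_le_sum fun y _ => ?_
    have hnonneg : 0 ≤ ∏ i, μ (x i, y i) * Real.exp (-(t * z (x i, y i))) :=
      Finset.prod_nonneg fun i _ => mul_nonneg (hμ0 _) (Real.exp_pos _).le
    rw [hsprod]
    split_ifs with hle
    · have hμprod : (∏ i, q.1 (x i)) * ∏ i, (p (x i)).1 (y i) = ∏ i, μ (x i, y i) :=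
        Finset.prod_mul_distrib.symm
      rw [hμprod, Finset.prod_mul_distrib (f := fun i => μ (x i, y i)), ← Real.exp_sum]
      by_cases h0 : ∏ i, μ (x i, y i) = 0
      · rw [h0, zero_mul]
      -- Markov's inequality termwise: on the low-likelihood event the `z`-values sum to at most
      -- `0`, so the exponential weight is at least `1`.
      refine le_mul_of_one_le_right (Finset.prod_nonneg fun i _ => hμ0 _) ?_
      rw [Real.one_le_exp_iff, Finset.sum_neg_distrib, ← Finset.mul_sum, neg_nonneg]
      refine mul_nonpos_of_nonneg_of_nonpos ht0.le ?_
      have hμpos (i) : μ (x i, y i) ≠ 0 := Finset.prod_ne_zero_iff.1 h0 i (Finset.mem_univ _)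
      have hppos (i) : 0 < (p (x i)).1 (y i) :=
        ((p (x i)).2.1 _).lt_of_ne (right_ne_zero_of_mul (hμpos i)).symm
      have hspos (i) : 0 < s (y i) := Finset.sum_pos'
        (fun x' _ => hμ0 (x', y i)) ⟨x i, Finset.mem_univ _, (hμ0 _).lt_of_ne (hμpos i).symm⟩
      simp only [hz, Finset.sum_sub_distrib, Finset.sum_const, Finset.card_univ,
        Fintype.card_fin, nsmul_eq_mul, sub_nonpos]
      rw [← Real.log_prod fun i _ => (div_pos (hppos i) (hspos i)).ne', ← mul_assoc,
        ← Real.log_rpow two_pos]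
      refine Real.log_le_log (Finset.prod_pos fun i _ => div_pos (hppos i) (hspos i)) ?_
      rw [Finset.prod_div_distrib, div_le_iff₀ (Finset.prod_pos fun i _ => hspos i)]
      exact hle
    · exact hnonneg

theorem informationCapacity_le_operationalCapacity :
    informationCapacity p ≤ operationalCapacity p := by
  refine iSup_le fun q => ?_
  have hach (R : ℝ) (hR : 0 ≤ R) (hRI : R < mutualInfo q p) :
        (R : EReal) ≤ operationalCapacity p := by
    refine le_iSup₂_of_le R ⟨hR, fun n₀ _ ε hε => ?_⟩ le_rfl
    obtain ⟨n, hn, hc⟩ := ((Filter.eventually_ge_atTop n₀).and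
      (eventually_codeExists p q hR hRI hε)).exists
    exact ⟨n, hn, hc⟩
  -- Achievable rates must be nonnegative, so this case uses rate `0`: one message, no error.
  rcases le_or_gt (mutualInfo q p) 0 with hI | hI
  · obtain ⟨x, -⟩ := Finset.exists_ne_zero_of_sum_ne_zero
      (q.2.2.symm ▸ one_ne_zero : ∑ a, q.1 a ≠ 0)
    refine (EReal.coe_le_coe_iff.2 hI).trans (le_iSup₂_of_le 0 ⟨le_rfl, fun n₀ _ ε hε =>
      ⟨n₀, le_rfl, fun _ _ => x, fun _ => ⟨0, by simp⟩, fun m => ?_⟩⟩ le_rfl)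
    rw [errorProb, Finset.sum_eq_zero]
    · exact hε.le
    · intro y hy
      refine absurd (Fin.ext ?_) (Finset.mem_filter.1 hy).2
      have := m.2
      simp only [mul_zero, Real.rpow_zero, Nat.floor_one] at this
      exact (Nat.lt_one_iff.1 this).symm
  · refine le_of_forall_lt fun c hc => ?_
    obtain ⟨R, hcR, hR⟩ := EReal.lt_iff_exists_real_btwn.1
      (max_lt hc (EReal.coe_lt_coe_iff.2 hI))
    exact ((le_max_left _ _).trans_lt hcR).trans_le (hach R
      (EReal.coe_le_coe_iff.1 ((le_max_right _ _).trans hcR.le)) (EReal.coe_lt_coe_iff.1 hR))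

end Achievability

end DMC

theorem mainTheorem4 {X Y : Type*} [Fintype X] [Fintype Y] (p : X → stdSimplex ℝ Y) :
    (∀ (n L : ℕ) (ε : ℝ), 0 < n → 0 < L → 0 < ε → ε < 1 →
      (GameChannel.IsGuaranteedWin (DMC.gameChannel p) n L ε ↔ DMC.CodeExists p n L ε) ∧
      (GameChannel.IsOnePassGuaranteedWin (DMC.gameChannel p) n L ε ↔ DMC.CodeExists p n L ε)) ∧
    GameChannel.capacity (DMC.gameChannel p) = DMC.operationalCapacity p ∧
    GameChannel.capacity (DMC.gameChannel p) = DMC.informationCapacity p :=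
  ⟨fun n L ε _ _ _ _ => ⟨DMC.isGuaranteedWin_iff_codeExists p n L ε,
      DMC.isOnePassGuaranteedWin_iff_codeExists p n L ε⟩,
    DMC.capacity_gameChannel_eq_operationalCapacity p,
    (DMC.capacity_gameChannel_eq_operationalCapacity p).trans
      (le_antisymm (DMC.operationalCapacity_le_informationCapacity p)
        (DMC.informationCapacity_le_operationalCapacity p))⟩
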